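/- Let $(\Omega,d)$ be a finite metric space whose points are partitioned into two groups $P_1$ (red) and $P_2$ (blue), and let $t\ge 1$, $k\ge 1$ be integers. A set $X\subseteq\Omega$ is $t$-balanced if $\tfrac1t\,|X\cap P_2|\le |X\cap P_1|\le t\,|X\cap P_2|$. A $(t,k)$-fair clustering is a partition of $\Omega$ into at most $k$ nonempty $t$-balanced clusters. The radius of a cluster $Q$ is $r(Q)=\min_{c\in\Omega}\max_{q\in Q}d(c,q)$, and the cost of a family of clusters is the sum of its radii. Let $\mathcal C^*$ be an optimal $(t,k)$-fair clustering, that is, one of minimum cost among all $(t,k)$-fair clusterings. Let $G$ be the complete bipartite graph with parts $P_1$ and $P_2$, with edge weights $w(\{p,q\})=d(p,q)$, and let $H$ be a spanning subgraph of $G$ that has minimum total weight among all spanning subgraphs of $G$ in which every vertex has degree in $[1,t]$. Starting from the family $\mathcal C^*$, repeatedly replace two different clusters of the current family by their union whenever $H$ has an edge with one endpoint in each of them, until no edge of $H$ joins two different clusters; let $\hat{\mathcal C}$ be the resulting family of superclusters. Then $$\sum_{\hat C\in\hat{\mathcal C}} r(\hat C)\;\le\; 8\sum_{C\in\mathcal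 C^*} r(C).$$ -/

import Mathlib

/-- The distance of a point `c` from a cluster `Q`, `max_{q ∈ Q} d(c, q)` (`0` if `Q` is empty). -/
noncomputable def distToCluster {Ω : Type*} [MetricSpace Ω] (c : Ω) (Q : Finset Ω) : ℝ :=
  ⨆ q : {q : Ω // q ∈ Q}, dist c q.1

/-- The radius of a cluster `Q`, `min_{c ∈ Ω} max_{q ∈ Q} d(c, q)`: the center may be any
point of the ground set. -/
noncomputable def clusterRadius {Ω : Type*} [MetricSpace Ω] (Q : Finset Ω) : ℝ :=
  ⨅ c : Ω, distToCluster c Q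

/-- The cost of a family of clusters: the sum of the radii. -/
noncomputable def sumOfRadii {Ω : Type*} [MetricSpace Ω] (𝒞 : Finset (Finset Ω)) : ℝ :=
  ∑ Q ∈ 𝒞, clusterRadius Q

/-- A cluster `X` is `t`-balanced for the groups `P₁`, `P₂`: the number of its points in `P₁` is
at least `1 / t` times and at most `t` times the number of its points in `P₂`. -/
def IsBalanced {Ω : Type*} [DecidableEq Ω] (P₁ P₂ : Finset Ω) (t : ℕ) (X : Finset Ω) : Prop :=
  (1 / (t : ℝ)) * ((X ∩ P₂).card : ℝ) ≤ ((X ∩ P₁).card : ℝ) ∧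
    ((X ∩ P₁).card : ℝ) ≤ (t : ℝ) * ((X ∩ P₂).card : ℝ)

/-- `𝒞` is a `(t, k)`-fair clustering of the whole space: a partition of it into at most `k`
nonempty clusters, each of which is `t`-balanced. (Empty clusters would have radius `0`
and are not listed.) -/
structure IsFairClustering {Ω : Type*} [Fintype Ω] [DecidableEq Ω] (P₁ P₂ : Finset Ω) (t k : ℕ)
    (𝒞 : Finpartition (Finset.univ : Finset Ω)) : Prop where
  card_le : 𝒞.parts.card ≤ k
  balanced : ∀ X ∈ 𝒞.parts, IsBalanced P₁ P₂ t X

/-- `𝒞` is an optimal `(t, k)`-fair clustering: it has the least sum of radii among all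
`(t, k)`-fair clusterings. -/
structure IsOptimalFairClustering {Ω : Type*} [MetricSpace Ω] [Fintype Ω] [DecidableEq Ω]
    (P₁ P₂ : Finset Ω) (t k : ℕ) (𝒞 : Finpartition (Finset.univ : Finset Ω)) : Prop where
  fair : IsFairClustering P₁ P₂ t k 𝒞
  optimal : ∀ 𝒟 : Finpartition (Finset.univ : Finset Ω), IsFairClustering P₁ P₂ t k 𝒟 →
    sumOfRadii 𝒞.parts ≤ sumOfRadii 𝒟.parts

open Classical in
/-- `H` is a degree constrained (spanning) subgraph of `G` for the degree bounds `l` and `u`. -/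
def IsDCS {V : Type*} [Fintype V] (G : SimpleGraph V) (l u : V → ℕ) (H : SimpleGraph V) : Prop :=
  H ≤ G ∧ ∀ v : V, l v ≤ H.degree v ∧ H.degree v ≤ u v

open Classical in
/-- The total weight of the edges of `H`. -/
noncomputable def graphWeight {V : Type*} [Fintype V] (w : Sym2 V → ℝ) (H : SimpleGraph V) : ℝ :=
  ∑ e ∈ H.edgeFinset, w e

/-- `H` is a min-cost degree constrained subgraph of `G` for the edge weights `w`. -/
def IsMinCostDCS {V : Type*} [Fintype V] (G : SimpleGraph V) (w : Sym2 V → ℝ) (l u : V → ℕ)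
    (H : SimpleGraph V) : Prop :=
  IsDCS G l u H ∧ ∀ H' : SimpleGraph V, IsDCS G l u H' → graphWeight w H ≤ graphWeight w H'

/-- The complete bipartite graph with parts `P₁` and `P₂` (for disjoint `P₁`, `P₂`). -/
def bichromaticGraph {Ω : Type*} (P₁ P₂ : Finset Ω) : SimpleGraph Ω :=
  (⊤ : SimpleGraph Ω).between (↑P₁ : Set Ω) (↑P₂ : Set Ω)

/-- The weight of the edge `{p, q}` is the distance `d(p, q)`. -/
noncomputable def distWeight {Ω : Type*} [MetricSpace Ω] : Sym2 Ω → ℝ :=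
  Sym2.lift ⟨fun p q => dist p q, dist_comm⟩

/-- One merging step: two different clusters `A`, `B` of the family, joined by an edge of `H`,
are replaced by their union. -/
def MergeStep {Ω : Type*} [DecidableEq Ω] (H : SimpleGraph Ω) (𝒜 ℬ : Finset (Finset Ω)) : Prop :=
  ∃ A ∈ 𝒜, ∃ B ∈ 𝒜, A ≠ B ∧ (∃ p ∈ A, ∃ q ∈ B, H.Adj p q) ∧
    ℬ = insert (A ∪ B) ((𝒜.erase A).erase B)

/-- `𝒮` is a family of superclusters obtained from the family `𝒞`: it results from `𝒞` by
finitely many merging steps (in some order), and no further merging step is possible. -/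
def IsSuperclustering {Ω : Type*} [DecidableEq Ω] (H : SimpleGraph Ω) (𝒞 𝒮 : Finset (Finset Ω)) :
    Prop :=
  Relation.ReflTransGen (MergeStep H) 𝒞 𝒮 ∧ ∀ 𝒮' : Finset (Finset Ω), ¬ MergeStep H 𝒮 𝒮'

/-!
Direct each edge of the minimum-cost subgraph `H` from its red to its blue end; this makes the
clusters into a directed graph (`ClusterArc`). The proof covers its arcs by short circuits.

*Exchange.* Take clusters in a cyclic order, a red point `a i` and a blue point `b i` in each, such
that each `a i` is joined in `H` to the blue point of the next cluster, except possibly where both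
of these points have degree less than `t`. Replacing these edges by the edges `a i — b i`, each
inside one cluster, keeps all degrees in `[1, t]`. By minimality the edges of `H` so used have
total length at most the sum of the diameters of the clusters (`IsMinCostDCS.sum_dist_le`).
Hence the union of the clusters on such a circuit has diameter at most `4 ∑ r`, counting `2 ∑ r`
for the edges and `2 ∑ r` for the clusters (`IsMinCostDCS.dist_le_of_circuit`).

*Every arc lies on a circuit* (`exists_circuit`). By minimality `H` is a union of stars
(`IsMinCostDCS.degree_le_one_of_adj`). Consider the set `U` of clusters reachable from the head of
an arc. If all red points of `U` had degree `t`, their neighbourhoods would be disjoint subsets of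
`U`, and would exhaust its blue points because `U` is balanced; then no edge could enter a blue
point of `U` from outside (`mem_of_adj_of_saturated`). So either the tail of the arc is reachable,
which closes a cycle, or a cluster with an unsaturated red point is; going backwards, the same
argument with the colours exchanged gives a cluster with an unsaturated blue point.

*Chains.* Any two points of a supercluster are joined by a chain of overlapping circuits. On a
shortest chain each cluster belongs to at most two circuits, so the distance of the points is at
most `2 · 4 ∑ r` (`dist_le_of_reflTransGen_of_cover`), which bounds the radius of the supercluster.
-/

/-! ### Radii of clusters -/

section Radius

variable {Ω : Type*} [MetricSpace Ω]

lemma clusterRadius_nonneg (Q : Finset Ω) : 0 ≤ clusterRadius Q :=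
  Real.iInf_nonneg fun _ => Real.iSup_nonneg fun _ => dist_nonneg

lemma dist_le_two_mul_clusterRadius [Finite Ω] {Q : Finset Ω} {x y : Ω} (hx : x ∈ Q)
    (hy : y ∈ Q) : dist x y ≤ 2 * clusterRadius Q := by
  have : Nonempty Ω := ⟨x⟩
  obtain ⟨c, hc⟩ := exists_eq_ciInf_of_finite (f := fun c : Ω => distToCluster c Q)
  have key : ∀ z ∈ Q, dist c z ≤ clusterRadius Q := fun z hz => by
    unfold clusterRadius
    rw [← hc]
    exact le_ciSup (f := fun q : {q : Ω // q ∈ Q} => dist c q.1) (Set.finite_range _).bddAbove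
      ⟨z, hz⟩
  have h1 := key x hx
  have h2 := key y hy
  have h3 := dist_triangle_left x y c
  linarith

lemma clusterRadius_le_of_dist_le {Q : Finset Ω} {x : Ω} (hx : x ∈ Q) {M : ℝ}
    (h : ∀ y ∈ Q, dist x y ≤ M) : clusterRadius Q ≤ M := by
  have : Nonempty {q : Ω // q ∈ Q} := ⟨⟨x, hx⟩⟩
  refine (ciInf_le ⟨0, ?_⟩ x).trans (ciSup_le fun q => h q.1 q.2)
  rintro _ ⟨c, rfl⟩
  exact Real.iSup_nonneg fun _ => dist_nonneg

end Radius

/-! ### Degrees in bipartite graphs and unions of stars -/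

section Degree

lemma bichromaticGraph_adj {Ω : Type*} {P₁ P₂ : Finset Ω} {x y : Ω} (hdisj : Disjoint P₁ P₂) :
    (bichromaticGraph P₁ P₂).Adj x y ↔ x ∈ P₁ ∧ y ∈ P₂ ∨ x ∈ P₂ ∧ y ∈ P₁ := by
  unfold bichromaticGraph
  rw [SimpleGraph.between_adj]
  simp only [SimpleGraph.top_adj, Finset.mem_coe, and_iff_right_iff_imp]
  rintro (⟨h1, h2⟩ | ⟨h1, h2⟩) rfl
  · exact Finset.disjoint_left.1 hdisj h1 h2
  · exact Finset.disjoint_left.1 hdisj h2 h1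

variable {Ω : Type*} [Fintype Ω] [DecidableEq Ω] {t : ℕ} {H : SimpleGraph Ω}

open Classical in
/-- Exchanging one edge at a vertex respects an upper degree bound. -/
lemma degree_le_of_exchange {H' : SimpleGraph Ω} {v new old : Ω}
    (h : ∀ u, H'.Adj v u → u = new ∨ H.Adj v u ∧ u ≠ old)
    (hold : H.Adj v old ∨ H.degree v < t) (hdeg : H.degree v ≤ t) : H'.degree v ≤ t := by
  have hsub : H'.neighborFinset v ⊆ insert new ((H.neighborFinset v).erase old) := by
    intro u hu
    rw [SimpleGraph.mem_neighborFinset] at hu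
    rcases h u hu with h | ⟨h1, h2⟩
    · simp [h]
    · simp [h1, h2]
  have hcard := (Finset.card_le_card hsub).trans (Finset.card_insert_le _ _)
  rw [SimpleGraph.card_neighborFinset_eq_degree] at hcard
  rcases hold with hold | hold
  · rw [Finset.card_erase_of_mem (by simpa using hold),
      SimpleGraph.card_neighborFinset_eq_degree] at hcard
    have : 0 < H.degree v := (H.degree_pos_iff_exists_adj v).2 ⟨old, hold⟩
    omega
  · have := Finset.card_erase_le (s := H.neighborFinset v) (a := old)
    rw [SimpleGraph.card_neighborFinset_eq_degree] at this
    omega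

open Classical in
/-- Suppose every point of `P` in `U` already has the maximum degree `t` and all its neighbours
in `U`. Since `H` consists of stars, these neighbourhoods are disjoint, so they use up all the
points of `Q` in `U`, of which there are at most `t` times as many as points of `P`; hence no edge
enters `U ∩ Q` from outside `U`. -/
lemma mem_of_adj_of_saturated {P Q : Finset Ω}
    (hbip : ∀ x y, H.Adj x y → x ∈ P → y ∈ Q)
    (hstar : ∀ x y, H.Adj x y → 2 ≤ H.degree x → H.degree y ≤ 1)
    (hdeg : ∀ v, H.degree v ≤ t) {U : Finset Ω} (hU : (U ∩ Q).card ≤ t * (U ∩ P).card)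
    (hsat : ∀ x ∈ U ∩ P, t ≤ H.degree x) (hclosed : ∀ x ∈ U ∩ P, ∀ y, H.Adj x y → y ∈ U)
    {x y : Ω} (hxy : H.Adj x y) (hyU : y ∈ U) (hyQ : y ∈ Q) : x ∈ U := by
  by_contra hxU
  -- a point of `Q` adjacent to a saturated point has no other neighbour
  have huniq : ∀ p ∈ U ∩ P, ∀ p' q, H.Adj p q → H.Adj p' q → p = p' := by
    intro p hp p' q hpq hpq'
    by_contra hne
    have h2 : 2 ≤ H.degree q := by
      rw [← SimpleGraph.card_neighborFinset_eq_degree]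
      exact Finset.one_lt_card.2 ⟨p, by simpa using hpq.symm, p', by simpa using hpq'.symm, hne⟩
    have h3 := hstar q p hpq.symm h2
    have h4 := hsat p hp
    have h5 := hdeg q
    omega
  have hsub : (U ∩ P).biUnion (fun p => H.neighborFinset p) ⊆ (U ∩ Q).erase y := by
    intro q hq
    obtain ⟨p, hp, hpq⟩ := Finset.mem_biUnion.1 hq
    rw [SimpleGraph.mem_neighborFinset] at hpq
    refine Finset.mem_erase.2 ⟨?_, Finset.mem_inter.2
      ⟨hclosed p hp q hpq, hbip p q hpq (Finset.mem_inter.1 hp).2⟩⟩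
    rintro rfl
    exact hxU (huniq p hp x _ hpq hxy ▸ (Finset.mem_inter.1 hp).1)
  have hcard := Finset.card_le_card hsub
  rw [Finset.card_biUnion, Finset.card_erase_of_mem (Finset.mem_inter.2 ⟨hyU, hyQ⟩)] at hcard
  · have h1 : (U ∩ P).card * t ≤ ∑ p ∈ U ∩ P, (H.neighborFinset p).card := by
      rw [← smul_eq_mul]
      refine Finset.card_nsmul_le_sum _ _ _ fun p hp => ?_
      rw [SimpleGraph.card_neighborFinset_eq_degree]
      exact hsat p hp
    have h2 : 0 < (U ∩ Q).card := Finset.card_pos.2 ⟨y, Finset.mem_inter.2 ⟨hyU, hyQ⟩⟩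
    rw [mul_comm] at h1
    omega
  · intro p hp p' hp' hne
    refine Finset.disjoint_left.2 fun q hq hq' => hne ?_
    rw [SimpleGraph.mem_neighborFinset] at hq hq'
    exact huniq p hp p' q hq hq'

end Degree

/-! ### Exchange arguments for a minimum-cost degree constrained subgraph -/

section Exchange

variable {Ω : Type*} [MetricSpace Ω] [Fintype Ω] [DecidableEq Ω] {P₁ P₂ : Finset Ω} {t : ℕ}
  {H : SimpleGraph Ω}

open Classical in
/-- A minimum-cost subgraph is a union of stars: an edge between two vertices of degree at least
two could be dropped. -/
lemma IsMinCostDCS.degree_le_one_of_adj {G : SimpleGraph Ω}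
    (hH : IsMinCostDCS G distWeight (fun _ => 1) (fun _ => t) H) {x y : Ω} (hxy : H.Adj x y)
    (hx : 2 ≤ H.degree x) : H.degree y ≤ 1 := by
  by_contra! hy
  obtain ⟨H', hH'⟩ : ∃ H' : SimpleGraph Ω, ∀ u v, H'.Adj u v ↔ H.Adj u v ∧ s(u, v) ≠ s(x, y) :=
    ⟨H.deleteEdges {s(x, y)}, fun u v => by simp [SimpleGraph.deleteEdges_adj]⟩
  have hle : H' ≤ H := fun u v h => ((hH' u v).1 h).1
  -- a vertex of degree at least two keeps a neighbour
  have hdeg : ∀ v w : Ω, s(v, w) = s(x, y) → 2 ≤ H.degree v → ∃ u, H'.Adj v u := by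
    intro v w hvw hv
    rw [← SimpleGraph.card_neighborFinset_eq_degree] at hv
    obtain ⟨u, hu, huw⟩ := Finset.exists_mem_ne hv w
    rw [SimpleGraph.mem_neighborFinset] at hu
    refine ⟨u, (hH' v u).2 ⟨hu, fun h => huw ?_⟩⟩
    rw [← hvw] at h
    exact Sym2.congr_right.1 h
  have hdcs : IsDCS G (fun _ => 1) (fun _ => t) H' := by
    refine ⟨hle.trans hH.1.1, fun v => ⟨?_, ?_⟩⟩
    · change 0 < H'.degree v
      rw [SimpleGraph.degree_pos_iff_exists_adj]
      by_cases hvx : v = x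
      · exact hdeg v y (by rw [hvx]) (hvx ▸ hx)
      by_cases hvy : v = y
      · exact hdeg v x (by rw [hvy, Sym2.eq_swap]) (hvy ▸ hy)
      · obtain ⟨u, hu⟩ := (H.degree_pos_iff_exists_adj v).1 (hH.1.2 v).1
        refine ⟨u, (hH' v u).2 ⟨hu, fun h => ?_⟩⟩
        rcases Sym2.eq_iff.1 h with ⟨h, -⟩ | ⟨h, -⟩
        exacts [hvx h, hvy h]
    · exact (Finset.card_le_card fun u hu => by
        simpa using hle ((H'.mem_neighborFinset v u).1 hu)).trans (hH.1.2 v).2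
  refine (hH.2 H' hdcs).not_gt ?_
  unfold graphWeight
  refine Finset.sum_lt_sum_of_subset (i := s(x, y)) (SimpleGraph.edgeFinset_mono hle)
    (by simpa using hxy) ?_ ?_ ?_
  · simp [hH']
  · exact dist_pos.2 hxy.ne
  · intro e _ _
    induction e with | _ u v => exact dist_nonneg

open Classical in
/-- The exchange inequality. The edges `a i — b (σ i)` of `H` can be replaced by the edges
`a i — b i`; where `a i — b (σ i)` is not an edge of `H`, both of its ends must have room for
one more edge. -/
lemma IsMinCostDCS.sum_dist_le (hdisj : Disjoint P₁ P₂)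
    (hH : IsMinCostDCS (bichromaticGraph P₁ P₂) distWeight (fun _ => 1) (fun _ => t) H)
    {ι : Type*} [Fintype ι] (a b : ι → Ω) (σ : Equiv.Perm ι)
    (ha : Function.Injective a) (hb : Function.Injective b)
    (haP : ∀ i, a i ∈ P₁) (hbP : ∀ i, b i ∈ P₂)
    (hσ : ∀ i, H.Adj (a i) (b (σ i)) ∨ H.degree (a i) < t ∧ H.degree (b (σ i)) < t) :
    ∑ i with H.Adj (a i) (b (σ i)), dist (a i) (b (σ i)) ≤ ∑ i, dist (a i) (b i) := by
  have hab : ∀ i j, a i ≠ b j := fun i j h =>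
    Finset.disjoint_left.1 hdisj (haP i) (h ▸ hbP j)
  obtain ⟨H', hH'⟩ : ∃ H' : SimpleGraph Ω, ∀ u v, H'.Adj u v ↔
      (H.Adj u v ∧ ∀ i, s(u, v) ≠ s(a i, b (σ i))) ∨ ∃ i, s(u, v) = s(a i, b i) := by
    refine ⟨H.deleteEdges (Set.range fun i => s(a i, b (σ i))) ⊔
      SimpleGraph.fromEdgeSet (Set.range fun i => s(a i, b i)), fun u v => ?_⟩
    simp only [SimpleGraph.sup_adj, SimpleGraph.deleteEdges_adj, SimpleGraph.fromEdgeSet_adj,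
      Set.mem_range, not_exists]
    refine or_congr (and_congr_right fun _ => forall_congr' fun i => ne_comm) ?_
    refine ⟨fun ⟨⟨i, h⟩, _⟩ => ⟨i, h.symm⟩, fun ⟨i, h⟩ => ⟨⟨i, h.symm⟩, ?_⟩⟩
    rintro rfl
    rcases Sym2.eq_iff.1 h with ⟨h1, h2⟩ | ⟨h1, h2⟩
    · exact hab i i (h1.symm.trans h2)
    · exact hab i i (h2.symm.trans h1)
  have hdcs : IsDCS (bichromaticGraph P₁ P₂) (fun _ => 1) (fun _ => t) H' := by
    refine ⟨fun u v huv => ?_, fun v => ⟨?_, ?_⟩⟩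
    · rcases (hH' u v).1 huv with h | ⟨i, h⟩
      · exact hH.1.1 h.1
      · rw [bichromaticGraph_adj hdisj]
        rcases Sym2.eq_iff.1 h with ⟨rfl, rfl⟩ | ⟨rfl, rfl⟩
        exacts [Or.inl ⟨haP i, hbP i⟩, Or.inr ⟨hbP i, haP i⟩]
    · change 0 < H'.degree v
      rw [SimpleGraph.degree_pos_iff_exists_adj]
      obtain ⟨u, hu⟩ := (H.degree_pos_iff_exists_adj v).1 (hH.1.2 v).1
      by_cases h : ∀ i, s(v, u) ≠ s(a i, b (σ i))
      · exact ⟨u, (hH' v u).2 (Or.inl ⟨hu, h⟩)⟩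
      · push Not at h
        obtain ⟨i, h⟩ := h
        rcases Sym2.eq_iff.1 h with ⟨h, -⟩ | ⟨h, -⟩
        · exact ⟨b i, (hH' _ _).2 (Or.inr ⟨i, by rw [h]⟩)⟩
        · exact ⟨a (σ i), (hH' _ _).2 (Or.inr ⟨σ i, by rw [h, Sym2.eq_swap]⟩)⟩
    · by_cases hva : ∃ i, v = a i
      · obtain ⟨i, rfl⟩ := hva
        refine degree_le_of_exchange (new := b i) (old := b (σ i)) (fun u hu => ?_)
          ((hσ i).imp_right And.left) (hH.1.2 _).2
        rcases (hH' _ u).1 hu with ⟨h1, h2⟩ | ⟨j, h⟩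
        · exact Or.inr ⟨h1, fun h => h2 i (by rw [h])⟩
        · rcases Sym2.eq_iff.1 h with ⟨h1, h2⟩ | ⟨h1, -⟩
          · exact Or.inl (by rw [h2, ha h1])
          · exact absurd h1 (hab i j)
      by_cases hvb : ∃ i, v = b (σ i)
      · obtain ⟨i, rfl⟩ := hvb
        refine degree_le_of_exchange (new := a (σ i)) (old := a i) (fun u hu => ?_)
          ((hσ i).imp (·.symm) And.right) (hH.1.2 _).2
        rcases (hH' _ u).1 hu with ⟨h1, h2⟩ | ⟨j, h⟩
        · exact Or.inr ⟨h1, fun h => h2 i (by rw [h, Sym2.eq_swap])⟩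
        · rcases Sym2.eq_iff.1 h with ⟨h1, -⟩ | ⟨h1, h2⟩
          · exact absurd h1.symm (hab j _)
          · exact Or.inl (by rw [h2, hb h1])
      · refine (Finset.card_le_card fun u hu => ?_ : _ ≤ H.degree v).trans (hH.1.2 v).2
        rw [SimpleGraph.mem_neighborFinset] at hu ⊢
        rcases (hH' _ u).1 hu with ⟨h1, -⟩ | ⟨j, h⟩
        · exact h1
        · rcases Sym2.eq_iff.1 h with ⟨h1, -⟩ | ⟨h1, -⟩
          · exact absurd ⟨j, h1⟩ hva
          · exact absurd ⟨σ.symm j, by simpa using h1⟩ hvb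
  have hmin := hH.2 H' hdcs
  unfold graphWeight at hmin
  have hnn : ∀ e : Sym2 Ω, 0 ≤ distWeight e := fun e => by
    induction e with | _ u v => exact dist_nonneg
  set F : Finset (Sym2 Ω) :=
    (Finset.univ.filter fun i => H.Adj (a i) (b (σ i))).image fun i => s(a i, b (σ i)) with hF
  have hFsub : F ⊆ H.edgeFinset := by
    intro e he
    obtain ⟨i, hi, rfl⟩ := Finset.mem_image.1 he
    simpa using hi
  have hFsum : ∑ e ∈ F, distWeight e
      = ∑ i with H.Adj (a i) (b (σ i)), dist (a i) (b (σ i)) := by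
    rw [hF, Finset.sum_image]
    · rfl
    · intro i _ j _ hij
      rcases Sym2.eq_iff.1 hij with ⟨h, -⟩ | ⟨h, -⟩
      · exact ha h
      · exact absurd h (hab _ _)
  have hsub : H'.edgeFinset ⊆
      (H.edgeFinset \ F) ∪ Finset.univ.image fun i => s(a i, b i) := by
    intro e he
    induction e with | _ u v =>
    rw [SimpleGraph.mem_edgeFinset, SimpleGraph.mem_edgeSet, hH'] at he
    rw [Finset.mem_union, Finset.mem_sdiff, SimpleGraph.mem_edgeFinset, SimpleGraph.mem_edgeSet]
    refine he.imp (fun ⟨h1, h2⟩ => ⟨h1, fun h => ?_⟩)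
      (fun ⟨i, h⟩ => Finset.mem_image.2 ⟨i, Finset.mem_univ _, h.symm⟩)
    obtain ⟨i, -, hi⟩ := Finset.mem_image.1 h
    exact h2 i hi.symm
  have h1 : ∑ e ∈ H'.edgeFinset, distWeight e ≤
      ∑ e ∈ H.edgeFinset \ F, distWeight e + ∑ i, dist (a i) (b i) := by
    refine (Finset.sum_le_sum_of_subset_of_nonneg hsub fun e _ _ => hnn e).trans ?_
    refine (le_add_of_nonneg_right (Finset.sum_nonneg fun e _ => hnn e)).trans
      (Finset.sum_union_inter).le |>.trans ?_
    gcongr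
    exact Finset.sum_image_le_of_nonneg (fun _ _ => hnn _)
  have h2 := Finset.sum_sdiff (f := distWeight) hFsub
  linarith

end Exchange

/-! ### Paths and cycles of clusters -/

section Circuit

/-- A vertex reachable along a relation is reachable along a chain without repetitions. -/
lemma exists_nodup_isChain_of_reflTransGen {α : Type*} {r : α → α → Prop} {x y : α}
    (h : Relation.ReflTransGen r x y) :
    ∃ l : List α, l.Nodup ∧ l.IsChain r ∧ l.head? = some x ∧ l.getLast? = some y ∧
      ∀ z ∈ l, Relation.ReflTransGen r x z ∧ Relation.ReflTransGen r z y := by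
  induction h using Relation.ReflTransGen.head_induction_on with
  | refl => exact ⟨[y], by simp, by simp, rfl, rfl, by simp [Relation.ReflTransGen.refl]⟩
  | @head x c hxc hcy ih =>
    obtain ⟨l, hnd, hch, hhd, hlast, hmem⟩ := ih
    by_cases hx : x ∈ l
    · obtain ⟨s, l', rfl⟩ := List.append_of_mem hx
      refine ⟨x :: l', (List.nodup_append.1 hnd).2.1, hch.suffix (List.suffix_append _ _), rfl,
        by simpa using hlast, fun z hz => ?_⟩
      have := hmem z (List.mem_append_right _ hz)
      exact ⟨this.1.head hxc, this.2⟩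
    · have hne : l ≠ [] := by rintro rfl; simp at hhd
      refine ⟨x :: l, List.nodup_cons.2 ⟨hx, hnd⟩, ?_, rfl, ?_, ?_⟩
      · rw [List.isChain_cons]
        refine ⟨fun c' hc' => ?_, hch⟩
        rw [hhd, Option.mem_some_iff] at hc'
        exact hc' ▸ hxc
      · rw [List.getLast?_cons, hlast]; rfl
      · intro z hz
        rcases List.mem_cons.1 hz with rfl | hz
        · exact ⟨.refl, hcy.head hxc⟩
        · exact ⟨(hmem z hz).1.head hxc, (hmem z hz).2⟩

/-- A property invariant under `r` is constant along an `r`-chain. -/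
lemma List.IsChain.forall_mem_of_mem {α : Type*} {r : α → α → Prop} {p : α → Prop}
    (hp : ∀ x y, r x y → (p x ↔ p y)) {l : List α} (hl : l.IsChain r) {x : α} (hx : x ∈ l)
    (hpx : p x) : ∀ y ∈ l, p y := by
  have key : ∀ i (hi : i < l.length), p l[i] ↔ p (l[0]'(by omega)) := by
    intro i
    induction i with
    | zero => exact fun _ => Iff.rfl
    | succ i ih =>
      exact fun hi => (hp _ _ (List.isChain_iff_getElem.1 hl i hi)).symm.trans (ih (by omega))
  obtain ⟨i, hi, rfl⟩ := List.mem_iff_getElem.1 hx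
  intro y hy
  obtain ⟨j, hj, rfl⟩ := List.mem_iff_getElem.1 hy
  exact (key j hj).2 ((key i hi).1 hpx)

variable {Ω : Type*} [Fintype Ω] [DecidableEq Ω] {P₁ P₂ : Finset Ω} {t : ℕ} {H : SimpleGraph Ω}
  {𝒞 : Finpartition (Finset.univ : Finset Ω)}

/-- The directed graph on the clusters of `𝒞` in which each edge of `H` between `P` and `Q` is
directed from its end in `P` to its end in `Q`. -/
def ClusterArc (H : SimpleGraph Ω) (P Q : Finset Ω) (𝒞 : Finpartition (Finset.univ : Finset Ω))
    (C D : Finset Ω) : Prop :=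
  C ∈ 𝒞.parts ∧ D ∈ 𝒞.parts ∧ ∃ a ∈ C, a ∈ P ∧ ∃ b ∈ D, b ∈ Q ∧ H.Adj a b

lemma clusterArc_swap {P Q C D : Finset Ω} :
    ClusterArc H P Q 𝒞 C D ↔ ClusterArc H Q P 𝒞 D C := by
  constructor <;> rintro ⟨hC, hD, a, ha, haP, b, hb, hbQ, hab⟩ <;>
    exact ⟨hD, hC, b, hb, hbQ, a, ha, haP, hab.symm⟩

lemma card_biUnion_inter {X : Finset (Finset Ω)} (hX : X ⊆ 𝒞.parts) (P : Finset Ω) :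
    (X.biUnion id ∩ P).card = ∑ D ∈ X, (D ∩ P).card := by
  rw [Finset.biUnion_inter, Finset.card_biUnion]
  · rfl
  · intro C hC D hD hne
    exact (𝒞.disjoint (hX hC) (hX hD) hne).mono Finset.inter_subset_left Finset.inter_subset_left

open Classical in
/-- From the head of an arc `C → C'` one can follow arcs until `C` is reached again or a cluster
with a point of `P` of degree less than `t`: otherwise the clusters reachable from `C'` would form
a saturated balanced set. -/
lemma exists_reachable_eq_or_slack {P Q : Finset Ω}
    (hbip : ∀ x y, H.Adj x y → x ∈ P → y ∈ Q)
    (hstar : ∀ x y, H.Adj x y → 2 ≤ H.degree x → H.degree y ≤ 1)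
    (hdeg : ∀ v, H.degree v ≤ t)
    (hbal : ∀ C ∈ 𝒞.parts, (C ∩ Q).card ≤ t * (C ∩ P).card) {C C' : Finset Ω}
    (h : ClusterArc H P Q 𝒞 C C') :
    ∃ D, Relation.ReflTransGen (ClusterArc H P Q 𝒞) C' D ∧
      (D = C ∨ ∃ a ∈ D, a ∈ P ∧ H.degree a < t) := by
  by_contra! hcon
  obtain ⟨hC, hC', a₀, ha₀, ha₀P, b₀, hb₀, hb₀Q, hab₀⟩ := h
  set X := 𝒞.parts.filter (Relation.ReflTransGen (ClusterArc H P Q 𝒞) C') with hXdef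
  have hX : X ⊆ 𝒞.parts := Finset.filter_subset _ _
  have hUmem : ∀ x, x ∈ X.biUnion id ↔ ∃ D ∈ X, x ∈ D := fun x => by simp
  have ha₀U : a₀ ∈ X.biUnion id := by
    refine mem_of_adj_of_saturated hbip hstar hdeg (U := X.biUnion id) ?_ ?_ ?_ hab₀ ?_ hb₀Q
    · rw [card_biUnion_inter hX, card_biUnion_inter hX, Finset.mul_sum]
      exact Finset.sum_le_sum fun D hD => hbal D (hX hD)
    · intro x hx
      obtain ⟨hxU, hxP⟩ := Finset.mem_inter.1 hx
      obtain ⟨D, hD, hxD⟩ := (hUmem x).1 hxU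
      exact (hcon D (Finset.mem_filter.1 hD).2).2 x hxD hxP
    · intro x hx y hxy
      obtain ⟨hxU, hxP⟩ := Finset.mem_inter.1 hx
      obtain ⟨D, hD, hxD⟩ := (hUmem x).1 hxU
      have hy : 𝒞.part y ∈ 𝒞.parts := 𝒞.part_mem.2 (Finset.mem_univ y)
      refine (hUmem y).2 ⟨𝒞.part y, Finset.mem_filter.2 ⟨hy, ?_⟩, 𝒞.mem_part (Finset.mem_univ y)⟩
      exact (Finset.mem_filter.1 hD).2.tail ⟨hX hD, hy, x, hxD, hxP, y,
        𝒞.mem_part (Finset.mem_univ y), hbip x y hxy hxP, hxy⟩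
    · exact (hUmem b₀).2 ⟨C', Finset.mem_filter.2 ⟨hC', .refl⟩, hb₀⟩
  obtain ⟨D, hD, haD⟩ := (hUmem a₀).1 ha₀U
  exact (hcon D (Finset.mem_filter.1 hD).2).1 (𝒞.eq_of_mem_parts (hX hD) hC haD ha₀)

open Classical in
/-- Every arc lies on a simple directed cycle of clusters, or on a simple directed path whose last
cluster has a point of `P₁` with room for another edge and whose first cluster has such a point
of `P₂`. -/
lemma exists_circuit
    (hbip₁ : ∀ x y, H.Adj x y → x ∈ P₁ → y ∈ P₂) (hbip₂ : ∀ x y, H.Adj x y → x ∈ P₂ → y ∈ P₁)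
    (hstar : ∀ x y, H.Adj x y → 2 ≤ H.degree x → H.degree y ≤ 1)
    (hdeg : ∀ v, H.degree v ≤ t)
    (hbal₁ : ∀ C ∈ 𝒞.parts, (C ∩ P₂).card ≤ t * (C ∩ P₁).card)
    (hbal₂ : ∀ C ∈ 𝒞.parts, (C ∩ P₁).card ≤ t * (C ∩ P₂).card)
    {C C' : Finset Ω} (h : ClusterArc H P₁ P₂ 𝒞 C C') :
    ∃ l : List (Finset Ω), l.Nodup ∧ l.IsChain (ClusterArc H P₁ P₂ 𝒞) ∧
      (∀ D ∈ l, D ∈ 𝒞.parts) ∧ C ∈ l ∧ C' ∈ l ∧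
      ∀ D ∈ l.getLast?, ∀ E ∈ l.head?, ClusterArc H P₁ P₂ 𝒞 D E ∨
        (∃ a ∈ D, a ∈ P₁ ∧ H.degree a < t) ∧ ∃ b ∈ E, b ∈ P₂ ∧ H.degree b < t := by
  have hto : ∀ {D E}, E ∈ 𝒞.parts → Relation.ReflTransGen (ClusterArc H P₁ P₂ 𝒞) D E →
      D ∈ 𝒞.parts := by
    intro D E hE hDE
    rcases hDE.cases_head with rfl | ⟨F, hF, -⟩
    exacts [hE, hF.1]
  have hfrom : ∀ {D E}, D ∈ 𝒞.parts → Relation.ReflTransGen (ClusterArc H P₁ P₂ 𝒞) D E →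
      E ∈ 𝒞.parts := by
    intro D E hD hDE
    rcases hDE.cases_tail with rfl | ⟨F, -, hF⟩
    exacts [hD, hF.2.1]
  by_cases hcyc : Relation.ReflTransGen (ClusterArc H P₁ P₂ 𝒞) C' C
  · obtain ⟨l, hnd, hch, hhd, hlast, hmem⟩ := exists_nodup_isChain_of_reflTransGen hcyc
    refine ⟨l, hnd, hch, fun D hD => hto h.1 (hmem D hD).2, List.mem_of_getLast? hlast,
      List.mem_of_head? hhd, ?_⟩
    rw [hhd, hlast]
    rintro _ ⟨⟩ _ ⟨⟩
    exact Or.inl h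
  · obtain ⟨D, hD, hD'⟩ := exists_reachable_eq_or_slack hbip₁ hstar hdeg hbal₁ h
    obtain ⟨E, hE, hE'⟩ := exists_reachable_eq_or_slack hbip₂ hstar hdeg hbal₂
      (clusterArc_swap.1 h)
    replace hE : Relation.ReflTransGen (ClusterArc H P₁ P₂ 𝒞) E C := by
      rw [← Relation.reflTransGen_swap]
      exact Relation.ReflTransGen.mono (fun _ _ => clusterArc_swap.1) _ _ hE
    replace hD' := hD'.resolve_left (by rintro rfl; exact hcyc hD)
    replace hE' := hE'.resolve_left (by rintro rfl; exact hcyc hE)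
    obtain ⟨l₁, hnd₁, hch₁, hhd₁, hlast₁, hmem₁⟩ := exists_nodup_isChain_of_reflTransGen hE
    obtain ⟨l₂, hnd₂, hch₂, hhd₂, hlast₂, hmem₂⟩ := exists_nodup_isChain_of_reflTransGen hD
    refine ⟨l₁ ++ l₂, List.nodup_append.2 ⟨hnd₁, hnd₂, ?_⟩, List.isChain_append.2
      ⟨hch₁, hch₂, ?_⟩, ?_, List.mem_append_left _ (List.mem_of_getLast? hlast₁),
      List.mem_append_right _ (List.mem_of_head? hhd₂), ?_⟩
    · rintro F hF₁ _ hF₂ rfl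
      exact hcyc ((hmem₂ F hF₂).1.trans (hmem₁ F hF₁).2)
    · rw [hlast₁, hhd₂]
      rintro _ ⟨⟩ _ ⟨⟩
      exact h
    · intro F hF
      rcases List.mem_append.1 hF with hF | hF
      · exact hto h.1 (hmem₁ F hF).2
      · exact hfrom h.2.1 (hmem₂ F hF).1
    · rw [List.getLast?_append, List.head?_append, hlast₂, hhd₁]
      rintro _ ⟨⟩ _ ⟨⟩
      exact Or.inr ⟨hD', hE'⟩

end Circuit

/-! ### The diameter of a circuit of clusters -/

section CircuitDiameter

variable {Ω : Type*} [MetricSpace Ω] [Fintype Ω]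

/-- Walking through a sequence of clusters in which consecutive clusters are joined by links of
length at most `e k`. -/
lemma dist_le_of_linked {C : ℕ → Finset Ω} {e : ℕ → ℝ} {x y : Ω} {i j n : ℕ} (hij : i ≤ j)
    (hj : j ≤ n) (he : ∀ k, 0 ≤ e k)
    (hlink : ∀ k < n, ∃ p ∈ C k, ∃ q ∈ C (k + 1), dist p q ≤ e k) (hx : x ∈ C i) (hy : y ∈ C j) :
    dist x y ≤ ∑ k ∈ Finset.range (n + 1), e k
      + ∑ k ∈ Finset.range (n + 1), 2 * clusterRadius (C k) := by
  have key : ∀ y ∈ C j, dist x y ≤ ∑ k ∈ Finset.Ico i j, e k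
      + ∑ k ∈ Finset.Ico i (j + 1), 2 * clusterRadius (C k) := by
    clear hy
    induction j, hij using Nat.le_induction with
    | base =>
      intro y hy
      simpa using dist_le_two_mul_clusterRadius hx hy
    | succ j hij ih =>
      intro y hy
      obtain ⟨p, hp, q, hq, hpq⟩ := hlink j (by omega)
      have h1 := ih (by omega) p hp
      have h2 := dist_le_two_mul_clusterRadius hq hy
      have h3 := dist_triangle4 x p q y
      rw [Finset.sum_Ico_succ_top hij, Finset.sum_Ico_succ_top (by omega : i ≤ j + 1)]
      linarith
  refine (key y hy).trans (add_le_add ?_ ?_)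
  · refine Finset.sum_le_sum_of_subset_of_nonneg (fun k hk => ?_) fun k _ _ => he k
    rw [Finset.mem_Ico] at hk
    exact Finset.mem_range.2 (by omega)
  · refine Finset.sum_le_sum_of_subset_of_nonneg (fun k hk => ?_)
      fun k _ _ => mul_nonneg zero_le_two (clusterRadius_nonneg _)
    rw [Finset.mem_Ico] at hk
    exact Finset.mem_range.2 (by omega)

variable [DecidableEq Ω] {P₁ P₂ : Finset Ω} {t : ℕ} {H : SimpleGraph Ω}
  {𝒞 : Finpartition (Finset.univ : Finset Ω)}

open Classical in
/-- The union of the clusters on a circuit has diameter at most four times the sum of their radii: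
the exchange inequality bounds the total length of the arcs by the sum of the diameters. -/
lemma IsMinCostDCS.dist_le_of_circuit (hdisj : Disjoint P₁ P₂)
    (hH : IsMinCostDCS (bichromaticGraph P₁ P₂) distWeight (fun _ => 1) (fun _ => t) H)
    {l : List (Finset Ω)} (hnd : l.Nodup) (hch : l.IsChain (ClusterArc H P₁ P₂ 𝒞))
    (hparts : ∀ D ∈ l, D ∈ 𝒞.parts)
    (hclose : ∀ D ∈ l.getLast?, ∀ E ∈ l.head?, ClusterArc H P₁ P₂ 𝒞 D E ∨
        (∃ a ∈ D, a ∈ P₁ ∧ H.degree a < t) ∧ ∃ b ∈ E, b ∈ P₂ ∧ H.degree b < t)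
    {D E : Finset Ω} (hD : D ∈ l) (hE : E ∈ l) {x y : Ω} (hx : x ∈ D) (hy : y ∈ E) :
    dist x y ≤ 4 * ∑ F ∈ l.toFinset, clusterRadius F := by
  obtain ⟨n, hn⟩ : ∃ n, l.length = n + 1 :=
    Nat.exists_eq_succ_of_ne_zero (by rintro h; simp [List.length_eq_zero_iff.1 h] at hD)
  set C : Fin (n + 1) → Finset Ω := fun i => l[i.1]'(by omega) with hC
  have hCinj : Function.Injective C := fun i j hij =>
    Fin.ext ((List.Nodup.getElem_inj_iff hnd).1 hij)
  have hCparts : ∀ i, C i ∈ 𝒞.parts := fun i => hparts _ (List.getElem_mem _)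
  have hCsurj : ∀ F, F ∈ l ↔ ∃ i, C i = F := fun F => by
    rw [List.mem_iff_getElem]
    exact ⟨fun ⟨i, hi, h⟩ => ⟨⟨i, by omega⟩, h⟩, fun ⟨i, h⟩ => ⟨i.1, by omega, h⟩⟩
  set σ := finRotate (n + 1) with hσ
  have hex : ∀ i, ∃ a ∈ C i, ∃ b ∈ C (σ i), a ∈ P₁ ∧ b ∈ P₂ ∧
      (H.Adj a b ∨ H.degree a < t ∧ H.degree b < t) ∧ (i.1 < n → H.Adj a b) := by
    intro i
    rcases Nat.lt_succ_iff_lt_or_eq.1 i.2 with hi | hi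
    · have hσi : σ i = ⟨i.1 + 1, by omega⟩ := finRotate_of_lt hi
      obtain ⟨-, -, a, ha, haP, b, hb, hbP, hab⟩ :=
        List.isChain_iff_getElem.1 hch i.1 (by omega)
      exact ⟨a, ha, b, by rw [hσi]; exact hb, haP, hbP, Or.inl hab, fun _ => hab⟩
    · have hi' : i = Fin.last n := Fin.ext hi
      have hσi : σ i = 0 := by rw [hi', hσ]; exact finRotate_last
      have hne : l ≠ [] := by rintro rfl; simp at hD
      have hlast : C i ∈ l.getLast? := by
        rw [List.getLast?_eq_getElem?, Option.mem_def, List.getElem?_eq_some_iff]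
        exact ⟨by omega, by simp [hC, hn, hi]⟩
      have hhead : C 0 ∈ l.head? := by
        rw [List.head?_eq_getElem?, Option.mem_def, List.getElem?_eq_some_iff]
        exact ⟨by omega, by simp [hC]⟩
      rw [hσi]
      rcases hclose _ hlast _ hhead with ⟨-, -, a, ha, haP, b, hb, hbP, hab⟩ |
        ⟨⟨a, ha, haP, had⟩, b, hb, hbP, hbd⟩
      · exact ⟨a, ha, b, hb, haP, hbP, Or.inl hab, fun _ => hab⟩
      · exact ⟨a, ha, b, hb, haP, hbP, Or.inr ⟨had, hbd⟩, fun h => by omega⟩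
  choose a ha b' hb' haP hbP hadj hlt using hex
  have hb : ∀ i, b' (σ.symm i) ∈ C i := fun i => by simpa using hb' (σ.symm i)
  have hinj : ∀ f : Fin (n + 1) → Ω, (∀ i, f i ∈ C i) → Function.Injective f :=
    fun f hf i j hij => hCinj
      (𝒞.eq_of_mem_parts (hCparts i) (hCparts j) (hf i) (by rw [hij]; exact hf j))
  have hadj' : ∀ i j, j = i →
      (H.Adj (a i) (b' j) ∨ H.degree (a i) < t ∧ H.degree (b' j) < t) := by
    rintro i _ rfl
    exact hadj _
  have hmain := hH.sum_dist_le hdisj a (fun i => b' (σ.symm i)) σ (hinj _ ha) (hinj _ hb) haP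
    (fun i => hbP _) fun i => hadj' i _ (σ.symm_apply_apply i)
  simp only [Equiv.symm_apply_apply] at hmain
  have hr : ∑ i, dist (a i) (b' (σ.symm i)) ≤ ∑ i, 2 * clusterRadius (C i) :=
    Finset.sum_le_sum fun i _ => dist_le_two_mul_clusterRadius (ha i) (hb i)
  have hsum : ∑ F ∈ l.toFinset, clusterRadius F = ∑ i, clusterRadius (C i) := by
    have : l.toFinset = Finset.univ.image C := by ext F; simp [hCsurj]
    rw [this, Finset.sum_image fun i _ j _ h => hCinj h]
  -- the cyclic index set is unrolled to natural numbers
  set e : Fin (n + 1) → ℝ := fun i => if H.Adj (a i) (b' i) then dist (a i) (b' i) else 0 with he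
  have hesum : ∑ i, e i = ∑ i with H.Adj (a i) (b' i), dist (a i) (b' i) :=
    (Finset.sum_filter _ _).symm
  have hunroll : ∀ f : Fin (n + 1) → ℝ,
      ∑ k ∈ Finset.range (n + 1), f (Fin.ofNat (n + 1) k) = ∑ i, f i := fun f => by
    rw [← Fin.sum_univ_eq_sum_range (fun k => f (Fin.ofNat (n + 1) k))]
    simp
  have key : ∀ i j : Fin (n + 1), i ≤ j → ∀ p ∈ C i, ∀ q ∈ C j,
      dist p q ≤ 4 * ∑ F ∈ l.toFinset, clusterRadius F := by
    intro i j hij p hp q hq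
    have := dist_le_of_linked (C := fun k => C (Fin.ofNat (n + 1) k))
      (e := fun k => e (Fin.ofNat (n + 1) k)) (x := p) (y := q) (i := i) (j := j) (n := n) hij
      (Nat.lt_succ_iff.1 j.2) (fun k => by simp only [he]; split_ifs <;> simp) ?_
      (by simpa using hp) (by simpa using hq)
    · rw [hunroll e, hunroll fun i => 2 * clusterRadius (C i), hesum] at this
      rw [← Finset.mul_sum] at this hr
      rw [hsum]
      linarith
    · intro k hk
      have hk1 : Fin.ofNat (n + 1) k = ⟨k, by omega⟩ := Fin.ext (by simp; omega)
      have hk2 : Fin.ofNat (n + 1) (k + 1) = σ ⟨k, by omega⟩ := by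
        rw [hσ, finRotate_of_lt hk]
        exact Fin.ext (Nat.mod_eq_of_lt (by omega))
      rw [hk1, hk2]
      refine ⟨_, ha _, _, hb' _, ?_⟩
      simp only [he]
      rw [if_pos (hlt ⟨k, _⟩ hk)]
  obtain ⟨i, rfl⟩ := (hCsurj D).1 hD
  obtain ⟨j, rfl⟩ := (hCsurj E).1 hE
  rcases le_total i j with hij | hij
  · exact key i j hij x hx y hy
  · rw [dist_comm]
    exact key j i hij y hy x hx

end CircuitDiameter

/-! ### Shortest chains of overlapping sets -/

/-- Points `x` and `y` are joined by a chain of sets `K` of labels, each of which comes with the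
distance bound `M * ∑ i ∈ K, ρ i`. On a shortest chain each label is used at most twice, since
two sets with a common label can be at most one step apart. -/
lemma dist_le_of_reflTransGen_of_cover {V ι : Type*} [PseudoMetricSpace V] (π : V → ι)
    {ρ : ι → ℝ} (hρ : ∀ i, 0 ≤ ρ i) {U : Finset ι} {𝒦 : Set (Finset ι)}
    (hsub : ∀ K ∈ 𝒦, K ⊆ U) (hsurj : ∀ i ∈ U, ∃ v, π v = i) {M : ℝ} (hM : 0 ≤ M)
    (hdist : ∀ K ∈ 𝒦, ∀ x y, π x ∈ K → π y ∈ K → dist x y ≤ M * ∑ i ∈ K, ρ i) {x y : V}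
    (h : Relation.ReflTransGen (fun x y => ∃ K ∈ 𝒦, π x ∈ K ∧ π y ∈ K) x y) :
    dist x y ≤ 2 * M * ∑ i ∈ U, ρ i := by
  classical
  let g : SimpleGraph V :=
    { Adj := fun x y => x ≠ y ∧ ∃ K ∈ 𝒦, π x ∈ K ∧ π y ∈ K
      symm := ⟨fun x y ⟨hne, K, hK, h1, h2⟩ => ⟨hne.symm, K, hK, h2, h1⟩⟩
      loopless := ⟨fun x h => h.1 rfl⟩ }
  have hwalk : ∀ {x y} {K}, K ∈ 𝒦 → π x ∈ K → π y ∈ K → ∃ p : g.Walk x y, p.length ≤ 1 := by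
    intro x y K hK hx hy
    by_cases hxy : x = y
    · subst hxy
      exact ⟨.nil, by simp⟩
    · have hadj : g.Adj x y := ⟨hxy, K, hK, hx, hy⟩
      exact ⟨hadj.toWalk, by simp⟩
  have hreach : g.Reachable x y := by
    induction h with
    | refl => exact .refl _
    | tail _ h ih =>
      obtain ⟨K, hK, h1, h2⟩ := h
      exact ih.trans ⟨(hwalk hK h1 h2).choose⟩
  obtain ⟨p, hp⟩ := hreach.exists_walk_length_eq_dist
  have hK : ∀ i : ℕ, ∃ K, i < p.length →
      K ∈ 𝒦 ∧ π (p.getVert i) ∈ K ∧ π (p.getVert (i + 1)) ∈ K := by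
    intro i
    by_cases hi : i < p.length
    · obtain ⟨-, K, hK⟩ := p.adj_getVert_succ hi
      exact ⟨K, fun _ => hK⟩
    · exact ⟨∅, fun h => absurd h hi⟩
  choose K hK using hK
  have hclose : ∀ d ∈ U, ∀ i j, j < p.length → d ∈ K i → d ∈ K j → i ≤ j → j ≤ i + 1 := by
    intro d hd i j hj hdi hdj hij
    obtain ⟨w, rfl⟩ := hsurj d hd
    obtain ⟨hKi, hi, -⟩ := hK i (by omega)
    obtain ⟨hKj, -, hj'⟩ := hK j hj
    obtain ⟨q, hq⟩ := hwalk hKi hi hdi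
    obtain ⟨q', hq'⟩ := hwalk hKj hdj hj'
    have := SimpleGraph.dist_le ((p.take i).append ((q.append q').append (p.drop (j + 1))))
    rw [SimpleGraph.Walk.length_append, SimpleGraph.Walk.length_append,
      SimpleGraph.Walk.length_append, SimpleGraph.Walk.take_length,
      SimpleGraph.Walk.drop_length, ← hp] at this
    omega
  have hcount : ∀ d ∈ U, ((Finset.range p.length).filter fun i => d ∈ K i).card ≤ 2 := by
    intro d hd
    rcases ((Finset.range p.length).filter fun i => d ∈ K i).eq_empty_or_nonempty with h0 | hne
    · simp [h0]
    · set m := ((Finset.range p.length).filter fun i => d ∈ K i).min' hne with hm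
      have hmem := Finset.mem_filter.1 (Finset.min'_mem _ hne)
      refine (Finset.card_le_card (t := {m, m + 1}) fun j hj => ?_).trans Finset.card_le_two
      have hmj : m ≤ j := Finset.min'_le _ _ hj
      obtain ⟨hj1, hj2⟩ := Finset.mem_filter.1 hj
      have := hclose d hd m j (Finset.mem_range.1 hj1) hmem.2 hj2 hmj
      rw [Finset.mem_insert, Finset.mem_singleton]
      omega
  calc dist x y = dist (p.getVert 0) (p.getVert p.length) := by simp
    _ ≤ ∑ i ∈ Finset.range p.length, dist (p.getVert i) (p.getVert (i + 1)) :=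
      dist_le_range_sum_dist p.getVert _
    _ ≤ ∑ i ∈ Finset.range p.length, M * ∑ d ∈ K i, ρ d := by
      refine Finset.sum_le_sum fun i hi => ?_
      obtain ⟨h1, h2, h3⟩ := hK i (Finset.mem_range.1 hi)
      exact hdist _ h1 _ _ h2 h3
    _ = M * ∑ d ∈ U, ∑ i ∈ (Finset.range p.length).filter (fun i => d ∈ K i), ρ d := by
      rw [← Finset.mul_sum]
      congr 1
      refine Finset.sum_comm' fun i d => ?_
      rw [Finset.mem_filter]
      refine ⟨fun ⟨hi, hd⟩ => ⟨⟨hi, hd⟩, ?_⟩, fun h => h.1⟩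
      exact hsub _ (hK i (Finset.mem_range.1 hi)).1 hd
    _ ≤ M * ∑ d ∈ U, 2 * ρ d := by
      refine mul_le_mul_of_nonneg_left (Finset.sum_le_sum fun d hd => ?_) hM
      rw [Finset.sum_const, nsmul_eq_mul]
      exact mul_le_mul_of_nonneg_right (by exact_mod_cast hcount d hd) (hρ d)
    _ = 2 * M * ∑ i ∈ U, ρ i := by rw [← Finset.mul_sum]; ring

/-! ### Superclusters -/

section Supercluster

variable {Ω : Type*} [Fintype Ω] [DecidableEq Ω] {H : SimpleGraph Ω}
  {𝒞 : Finpartition (Finset.univ : Finset Ω)}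

/-- `𝒜` is a partition of the space into unions of clusters of `𝒞`, each connected through
clusters and edges of `H`. -/
structure IsConnectedCoarsening (H : SimpleGraph Ω)
    (𝒞 : Finpartition (Finset.univ : Finset Ω)) (𝒜 : Finset (Finset Ω)) : Prop where
  disjoint : ∀ A ∈ 𝒜, ∀ B ∈ 𝒜, A ≠ B → Disjoint A B
  cover : ∀ x, ∃ A ∈ 𝒜, x ∈ A
  nonempty : ∀ A ∈ 𝒜, A.Nonempty
  part_closed : ∀ A ∈ 𝒜, ∀ x ∈ A, ∀ y, 𝒞.part x = 𝒞.part y → y ∈ A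
  connected : ∀ A ∈ 𝒜, ∀ x ∈ A, ∀ y ∈ A,
    Relation.ReflTransGen (fun x y => H.Adj x y ∨ 𝒞.part x = 𝒞.part y) x y

lemma isConnectedCoarsening_parts : IsConnectedCoarsening H 𝒞 𝒞.parts where
  disjoint _ hA _ hB hne := 𝒞.disjoint hA hB hne
  cover x := ⟨𝒞.part x, 𝒞.part_mem.2 (Finset.mem_univ x), 𝒞.mem_part (Finset.mem_univ x)⟩
  nonempty _ hA := 𝒞.nonempty_of_mem_parts hA
  part_closed A hA x hx y hxy := by
    rw [← 𝒞.part_eq_of_mem hA hx, hxy]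
    exact 𝒞.mem_part (Finset.mem_univ y)
  connected A hA x hx y hy :=
    .single (Or.inr (by rw [𝒞.part_eq_of_mem hA hx, 𝒞.part_eq_of_mem hA hy]))

lemma IsConnectedCoarsening.mergeStep {𝒜 ℬ : Finset (Finset Ω)}
    (h : IsConnectedCoarsening H 𝒞 𝒜) (hstep : MergeStep H 𝒜 ℬ) :
    IsConnectedCoarsening H 𝒞 ℬ := by
  obtain ⟨A, hA, B, hB, hAB, ⟨p, hp, q, hq, hpq⟩, rfl⟩ := hstep
  have hdisj : ∀ D ∈ (𝒜.erase A).erase B, Disjoint (A ∪ B) D := by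
    intro D hD
    simp only [Finset.mem_erase] at hD
    exact Finset.disjoint_union_left.2
      ⟨h.disjoint A hA D hD.2.2 (Ne.symm hD.2.1), h.disjoint B hB D hD.2.2 (Ne.symm hD.1)⟩
  have hmem : ∀ D ∈ (𝒜.erase A).erase B, D ∈ 𝒜 := fun D hD =>
    Finset.mem_of_mem_erase (Finset.mem_of_mem_erase hD)
  refine ⟨?_, ?_, ?_, ?_, ?_⟩
  · intro D hD E hE hne
    rcases Finset.mem_insert.1 hD with rfl | hD <;> rcases Finset.mem_insert.1 hE with rfl | hE
    · exact absurd rfl hne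
    · exact hdisj E hE
    · exact (hdisj D hD).symm
    · exact h.disjoint D (hmem D hD) E (hmem E hE) hne
  · intro x
    obtain ⟨D, hD, hx⟩ := h.cover x
    by_cases hDA : D = A
    · exact ⟨_, Finset.mem_insert_self _ _, Finset.mem_union_left _ (hDA ▸ hx)⟩
    by_cases hDB : D = B
    · exact ⟨_, Finset.mem_insert_self _ _, Finset.mem_union_right _ (hDB ▸ hx)⟩
    · exact ⟨D, Finset.mem_insert_of_mem (by simp [hDA, hDB, hD]), hx⟩
  · intro D hD
    rcases Finset.mem_insert.1 hD with rfl | hD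
    · exact ⟨p, Finset.mem_union_left _ hp⟩
    · exact h.nonempty D (hmem D hD)
  · intro D hD x hx y hxy
    rcases Finset.mem_insert.1 hD with rfl | hD
    · exact Finset.mem_union.2 ((Finset.mem_union.1 hx).imp
        (fun hx => h.part_closed A hA x hx y hxy) (fun hx => h.part_closed B hB x hx y hxy))
    · exact h.part_closed D (hmem D hD) x hx y hxy
  · intro D hD x hx y hy
    rcases Finset.mem_insert.1 hD with rfl | hD
    · rcases Finset.mem_union.1 hx with hx | hx <;> rcases Finset.mem_union.1 hy with hy | hy
      · exact h.connected A hA x hx y hy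
      · exact ((h.connected A hA x hx p hp).tail (Or.inl hpq)).trans
          (h.connected B hB q hq y hy)
      · exact ((h.connected B hB x hx q hq).tail (Or.inl hpq.symm)).trans
          (h.connected A hA p hp y hy)
      · exact h.connected B hB x hx y hy
    · exact h.connected D (hmem D hD) x hx y hy

lemma IsSuperclustering.isConnectedCoarsening {𝒮 : Finset (Finset Ω)}
    (h : IsSuperclustering H 𝒞.parts 𝒮) : IsConnectedCoarsening H 𝒞 𝒮 := by
  obtain ⟨h, -⟩ := h
  induction h with
  | refl => exact isConnectedCoarsening_parts
  | tail _ hstep ih => exact ih.mergeStep hstep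

lemma IsSuperclustering.mem_of_adj {𝒮 : Finset (Finset Ω)}
    (h : IsSuperclustering H 𝒞.parts 𝒮) {S : Finset Ω} (hS : S ∈ 𝒮) {x y : Ω} (hx : x ∈ S)
    (hxy : H.Adj x y) : y ∈ S := by
  obtain ⟨T, hT, hy⟩ := h.isConnectedCoarsening.cover y
  by_contra hyS
  exact h.2 _ ⟨S, hS, T, hT, by rintro rfl; exact hyS hy, ⟨x, hx, y, hy, hxy⟩, rfl⟩

end Supercluster

/-! ### The radius of a supercluster -/

lemma IsBalanced.card_le {Ω : Type*} [DecidableEq Ω] {P₁ P₂ X : Finset Ω} {t : ℕ} (ht : 1 ≤ t)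
    (h : IsBalanced P₁ P₂ t X) :
    (X ∩ P₂).card ≤ t * (X ∩ P₁).card ∧ (X ∩ P₁).card ≤ t * (X ∩ P₂).card := by
  obtain ⟨h1, h2⟩ := h
  have ht0 : (0 : ℝ) < t := by exact_mod_cast ht
  rw [one_div, inv_mul_le_iff₀ ht0] at h1
  exact ⟨by exact_mod_cast h1, by exact_mod_cast h2⟩

open Classical in
/-- A supercluster has radius at most eight times the total radius of its clusters. -/
lemma clusterRadius_supercluster_le {Ω : Type*} [MetricSpace Ω] [Fintype Ω] [DecidableEq Ω]
    {P₁ P₂ : Finset Ω} (hdisj : Disjoint P₁ P₂) {t : ℕ}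
    {𝒞 : Finpartition (Finset.univ : Finset Ω)}
    (hbal₁ : ∀ C ∈ 𝒞.parts, (C ∩ P₂).card ≤ t * (C ∩ P₁).card)
    (hbal₂ : ∀ C ∈ 𝒞.parts, (C ∩ P₁).card ≤ t * (C ∩ P₂).card)
    {H : SimpleGraph Ω}
    (hH : IsMinCostDCS (bichromaticGraph P₁ P₂) distWeight (fun _ => 1) (fun _ => t) H)
    {𝒮 : Finset (Finset Ω)} (h𝒮 : IsSuperclustering H 𝒞.parts 𝒮) {S : Finset Ω} (hS : S ∈ 𝒮) :
    clusterRadius S ≤ 8 * ∑ C ∈ 𝒞.parts.filter (· ⊆ S), clusterRadius C := by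
  have hcoarse := h𝒮.isConnectedCoarsening
  have hadj : ∀ x y, H.Adj x y → x ∈ P₁ ∧ y ∈ P₂ ∨ x ∈ P₂ ∧ y ∈ P₁ := fun x y hxy =>
    (bichromaticGraph_adj hdisj).1 (hH.1.1 hxy)
  have hbip₁ : ∀ x y, H.Adj x y → x ∈ P₁ → y ∈ P₂ := fun x y hxy hx =>
    (hadj x y hxy).elim And.right fun h => absurd h.1 (Finset.disjoint_left.1 hdisj hx)
  have hbip₂ : ∀ x y, H.Adj x y → x ∈ P₂ → y ∈ P₁ := fun x y hxy hx =>
    (hadj x y hxy).elim (fun h => absurd hx (Finset.disjoint_left.1 hdisj h.1)) And.right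
  have hstar : ∀ x y, H.Adj x y → 2 ≤ H.degree x → H.degree y ≤ 1 := fun x y hxy hx =>
    hH.degree_le_one_of_adj hxy hx
  have hpart : ∀ z, 𝒞.part z ∈ 𝒞.parts := fun z => 𝒞.part_mem.2 (Finset.mem_univ z)
  have hmempart : ∀ z, z ∈ 𝒞.part z := fun z => 𝒞.mem_part (Finset.mem_univ z)
  have hpartS : ∀ D ∈ 𝒞.parts, ∀ z ∈ D, z ∈ S → D ⊆ S := by
    intro D hD z hz hzS w hw
    exact hcoarse.part_closed S hS z hzS w
      (by rw [𝒞.part_eq_of_mem hD hz, 𝒞.part_eq_of_mem hD hw])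
  set 𝒦 : Set (Finset (Finset Ω)) := {K | K ⊆ 𝒞.parts.filter (· ⊆ S) ∧
    ∀ x y, 𝒞.part x ∈ K → 𝒞.part y ∈ K → dist x y ≤ 4 * ∑ C ∈ K, clusterRadius C} with h𝒦
  have hsame : ∀ x ∈ S, ∀ y, 𝒞.part x = 𝒞.part y → ∃ K ∈ 𝒦, 𝒞.part x ∈ K ∧ 𝒞.part y ∈ K := by
    intro x hx y hxy
    refine ⟨{𝒞.part x}, ⟨?_, ?_⟩, by simp, by simp [hxy]⟩
    · rw [Finset.singleton_subset_iff, Finset.mem_filter]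
      exact ⟨hpart x, hpartS _ (hpart x) x (hmempart x) hx⟩
    · intro u v hu hv
      rw [Finset.mem_singleton] at hu hv
      rw [Finset.sum_singleton]
      have h1 := dist_le_two_mul_clusterRadius (hu ▸ hmempart u) (hv ▸ hmempart v)
      have h2 := clusterRadius_nonneg (𝒞.part x)
      linarith
  have harc : ∀ x ∈ S, ∀ y, H.Adj x y → x ∈ P₁ → y ∈ P₂ →
      ∃ K ∈ 𝒦, 𝒞.part x ∈ K ∧ 𝒞.part y ∈ K := by
    intro x hx y hxy hxP hyP
    obtain ⟨l, hnd, hch, hparts, hxl, hyl, hclose⟩ :=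
      exists_circuit hbip₁ hbip₂ hstar (fun v => (hH.1.2 v).2) hbal₁ hbal₂
        (C := 𝒞.part x) (C' := 𝒞.part y)
        ⟨hpart x, hpart y, x, hmempart x, hxP, y, hmempart y, hyP, hxy⟩
    have hlS : ∀ D ∈ l, D ⊆ S := by
      refine hch.forall_mem_of_mem (p := (· ⊆ S)) ?_ hxl (hpartS _ (hpart x) x (hmempart x) hx)
      rintro D E ⟨hD, hE, a, ha, -, b, hb, -, hab⟩
      exact ⟨fun h => hpartS E hE b hb (h𝒮.mem_of_adj hS (h ha) hab),
        fun h => hpartS D hD a ha (h𝒮.mem_of_adj hS (h hb) hab.symm)⟩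
    refine ⟨l.toFinset, ⟨fun D hD => ?_, fun u v hu hv => ?_⟩, by simpa using hxl,
      by simpa using hyl⟩
    · rw [List.mem_toFinset] at hD
      exact Finset.mem_filter.2 ⟨hparts D hD, hlS D hD⟩
    · exact hH.dist_le_of_circuit hdisj hnd hch hparts hclose (List.mem_toFinset.1 hu)
        (List.mem_toFinset.1 hv) (hmempart u) (hmempart v)
  have hstep : ∀ x ∈ S, ∀ y, H.Adj x y ∨ 𝒞.part x = 𝒞.part y →
      y ∈ S ∧ ∃ K ∈ 𝒦, 𝒞.part x ∈ K ∧ 𝒞.part y ∈ K := by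
    rintro x hx y (hxy | hxy)
    · have hy := h𝒮.mem_of_adj hS hx hxy
      refine ⟨hy, ?_⟩
      rcases hadj x y hxy with ⟨h1, h2⟩ | ⟨h1, h2⟩
      · exact harc x hx y hxy h1 h2
      · obtain ⟨K, hK, h3, h4⟩ := harc y hy x hxy.symm h2 h1
        exact ⟨K, hK, h4, h3⟩
    · exact ⟨hcoarse.part_closed S hS x hx y hxy, hsame x hx y hxy⟩
  obtain ⟨x, hx⟩ := hcoarse.nonempty S hS
  refine clusterRadius_le_of_dist_le hx fun y hy => ?_
  have hchain : y ∈ S ∧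
      Relation.ReflTransGen (fun x y => ∃ K ∈ 𝒦, 𝒞.part x ∈ K ∧ 𝒞.part y ∈ K) x y := by
    have := hcoarse.connected S hS x hx y hy
    clear hy
    induction this with
    | refl => exact ⟨hx, .refl⟩
    | tail _ h ih =>
      obtain ⟨h1, h2⟩ := hstep _ ih.1 _ h
      exact ⟨h1, ih.2.tail h2⟩
  have := dist_le_of_reflTransGen_of_cover 𝒞.part (ρ := clusterRadius) clusterRadius_nonneg
    (fun K hK => hK.1) ?_ (by norm_num : (0 : ℝ) ≤ 4) (fun K hK => hK.2) hchain.2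
  · linarith
  · intro D hD
    have hD := (Finset.mem_filter.1 hD).1
    obtain ⟨z, hz⟩ := 𝒞.nonempty_of_mem_parts hD
    exact ⟨z, 𝒞.part_eq_of_mem hD hz⟩

theorem mainTheorem3 {Ω : Type*} [MetricSpace Ω] [Fintype Ω] [DecidableEq Ω]
    (P₁ P₂ : Finset Ω) (hdisj : Disjoint P₁ P₂) (hcover : P₁ ∪ P₂ = Finset.univ)
    (t k : ℕ) (ht : 1 ≤ t) (hk : 1 ≤ k)
    (𝒞 : Finpartition (Finset.univ : Finset Ω)) (h𝒞 : IsOptimalFairClustering P₁ P₂ t k 𝒞)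
    (H : SimpleGraph Ω)
    (hH : IsMinCostDCS (bichromaticGraph P₁ P₂) distWeight (fun _ => 1) (fun _ => t) H)
    (𝒮 : Finset (Finset Ω)) (h𝒮 : IsSuperclustering H 𝒞.parts 𝒮) :
    sumOfRadii 𝒮 ≤ 8 * sumOfRadii 𝒞.parts := by
  have hbal := fun C hC => (h𝒞.fair.balanced C hC).card_le ht
  have hcoarse := h𝒮.isConnectedCoarsening
  unfold sumOfRadii
  calc ∑ S ∈ 𝒮, clusterRadius S
      ≤ ∑ S ∈ 𝒮, 8 * ∑ C ∈ 𝒞.parts.filter (· ⊆ S), clusterRadius C :=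
        Finset.sum_le_sum fun S hS => clusterRadius_supercluster_le hdisj
          (fun C hC => (hbal C hC).1) (fun C hC => (hbal C hC).2) hH h𝒮 hS
    _ = 8 * ∑ C ∈ 𝒮.biUnion fun S => 𝒞.parts.filter (· ⊆ S), clusterRadius C := by
      rw [← Finset.mul_sum, Finset.sum_biUnion]
      intro S hS T hT hne
      refine Finset.disjoint_left.2 fun C hCS hCT => ?_
      obtain ⟨hC, hCS⟩ := Finset.mem_filter.1 hCS
      obtain ⟨x, hx⟩ := 𝒞.nonempty_of_mem_parts hC
      exact Finset.disjoint_left.1 (hcoarse.disjoint S hS T hT hne) (hCS hx)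
        ((Finset.mem_filter.1 hCT).2 hx)
    _ ≤ 8 * ∑ C ∈ 𝒞.parts, clusterRadius C := by
      refine mul_le_mul_of_nonneg_left ?_ (by norm_num)
      exact Finset.sum_le_sum_of_subset_of_nonneg
        (Finset.biUnion_subset.2 fun S _ => Finset.filter_subset _ _)
        fun C _ _ => clusterRadius_nonneg C
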